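/- Let $(X,\|\cdot\|_X)$ be a Banach space over $\mathbb K\in\{\mathbb R,\mathbb C\}$ and $\tau_X$ a Hausdorff locally convex topology on $X$ such that $(X,\|\cdot\|_X,\tau_X)$ is a Saks space, i.e. $\tau_X$ is coarser than the norm topology and $(X,\tau_X)'$ is norming: $\|x\|_X=\sup\{|x'(x)| : x'\in (X,\tau_X)',\ \|x'\|_{X'}\le 1\}$ for all $x\in X$. Let $\gamma_X$ be the mixed topology, i.e. the finest linear topology on $X$ that coincides with $\tau_X$ on $\|\cdot\|_X$-bounded sets and satisfies $\tau_X\subseteq\gamma_X\subseteq\tau_{\|\cdot\|_X}$, where $\tau_{\|\cdot\|_X}$ is the norm topology. Assume that $(X,\gamma_X)$ is sequentially complete and C-sequential (every convex sequentially open subset of $(X,\gamma_X)$ is open). Let $(S_t)_{t\ge 0}$ be a locally $\tau_X$-bi-continuous semigroup on $X$: each $S_t$ is a bounded linear operator on $(X,\|\cdot\|_X)$, $S_0=I$, $S_{t+s}=S_tS_s$ for $s,t\ge 0$; there are $M\ge 1$ and $\omega\in\mathbb R$ with $\|S_t\|\le M e^{\omega t}$ for all $t\ge 0$; for every $x\in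 X$ the map $[0,\infty)\ni t\mapsto S_tx\in(X,\tau_X)$ is continuous; and whenever $(x_n)$ is a $\|\cdot\|_X$-bounded sequence with $\tau_X$-limit $x\in X$, then $S_t(x_n-x)\to 0$ in $\tau_X$ uniformly for $t\in[0,T]$, for every $T\geq 0$. Let $X^\circ$ be the space of all $x'\in X'$ (the norm dual) that are sequentially $\tau_X$-continuous on $\|\cdot\|_X$-bounded sets, with the norm of $X'$. Then for all $t\ge 0$ and $x^\circ\in X^\circ$ one has $S_t'x^\circ=x^\circ\circ S_t\in X^\circ$; the maps $S_t^\circ x^\circ:=S_t'x^\circ$ are bounded linear operators on $X^\circ$; $S_0^\circ=I$ and $S^\circ_{t+s}=S^\circ_tS^\circ_s$ for $s,t\ge0$; there are $M\ge1$, $\omega\in\mathbb R$ with $\|S_t^\circ\|\le Me^{\omega t}$ for all $t\ge0$; and for every $x^\circ\in X^\circ$ the map $[0,\infty)\ni t\mapsto S_t^\circ x^\circ\in X^\circ$ is continuous for the topology of uniform convergence on $\|\cdot\|_X$-compact subsets of $X$. -/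

import Mathlib

open Filter Topology Bornology
open scoped NNReal

/-- A further topology on `X`. It is wrapped in a structure so that instance search never confuses
it with the norm topology of `X`: below, every topology found by instance search (for instance the
one in `X →L[𝕜] X` or in `StrongDual 𝕜 X`) is the norm topology. -/
structure ExtraTopology (X : Type*) where
  top : TopologicalSpace X

/-- The norm topology. -/
abbrev normTopology (X : Type*) [NormedAddCommGroup X] : TopologicalSpace X :=
  UniformSpace.toTopologicalSpace

/-- A linear topology on a vector space: addition and scalar multiplication are continuous. -/
structure IsLinearTopologyOn (𝕜 : Type*) [RCLike 𝕜] {X : Type*} [AddCommGroup X] [Module 𝕜 X]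
    (σ : ExtraTopology X) : Prop where
  add : @IsTopologicalAddGroup X σ.top _
  smul : @ContinuousSMul 𝕜 X _ _ σ.top

/-- Two topologies coincide on every norm-bounded set. -/
def AgreeOnBounded {X : Type*} [NormedAddCommGroup X] (σ τ : ExtraTopology X) : Prop :=
  ∀ B : Set X, IsBounded B →
    TopologicalSpace.induced (Subtype.val : B → X) σ.top =
      TopologicalSpace.induced (Subtype.val : B → X) τ.top

/-- `(X, ‖·‖, τ)` is a Saks space: `X` is a Banach space, `τ` is a Hausdorff locally convex
topology coarser than the norm topology, and the `τ`-continuous functionals are norming.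
(In Mathlib's order on topologies `σ ≤ τ` means that `σ` is finer than `τ`.) -/
structure IsSaksSpace (𝕜 : Type*) [RCLike 𝕜] (X : Type*) [NormedAddCommGroup X]
    [NormedSpace 𝕜 X] [Module ℝ X] (τ : ExtraTopology X) : Prop where
  complete : CompleteSpace X
  linear : IsLinearTopologyOn 𝕜 τ
  hausdorff : @T2Space X τ.top
  locallyConvex : @LocallyConvexSpace ℝ X _ _ _ _ τ.top
  coarser : normTopology X ≤ τ.top
  norming : ∀ x : X, IsLUB
    {r : ℝ | ∃ f : StrongDual 𝕜 X, Continuous[τ.top, inferInstance] f ∧ ‖f‖ ≤ 1 ∧ r = ‖f x‖} ‖x‖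

/-- The linear topologies that lie between `τ` and the norm topology and coincide with `τ` on
norm-bounded sets. -/
def mixedCandidates (𝕜 : Type*) [RCLike 𝕜] {X : Type*} [NormedAddCommGroup X]
    [NormedSpace 𝕜 X] (τ : ExtraTopology X) : Set (TopologicalSpace X) :=
  {σ | IsLinearTopologyOn 𝕜 ⟨σ⟩ ∧ AgreeOnBounded ⟨σ⟩ τ ∧ normTopology X ≤ σ ∧ σ ≤ τ.top}

/-- The mixed topology `γ(‖·‖, τ)`: the finest element of `mixedCandidates`
(see `isLeast_mixedTopology`). -/
def mixedTopology (𝕜 : Type*) [RCLike 𝕜] {X : Type*} [NormedAddCommGroup X]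
    [NormedSpace 𝕜 X] (τ : ExtraTopology X) : ExtraTopology X :=
  ⟨sInf (mixedCandidates 𝕜 τ)⟩

/-- On a Saks space `mixedTopology` really is the finest among its candidates. -/
theorem isLeast_mixedTopology (𝕜 : Type*) [RCLike 𝕜] {X : Type*} [NormedAddCommGroup X]
    [NormedSpace 𝕜 X] [Module ℝ X] (τ : ExtraTopology X) (hτ : IsSaksSpace 𝕜 X τ) :
    IsLeast (mixedCandidates 𝕜 τ) (mixedTopology 𝕜 τ).top := by
  have hmem : τ.top ∈ mixedCandidates 𝕜 τ := ⟨hτ.linear, fun _ _ => rfl, hτ.coarser, le_rfl⟩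
  refine ⟨⟨⟨?_, ?_⟩, ?_, ?_, sInf_le hmem⟩, fun σ hσ => sInf_le hσ⟩
  · exact topologicalAddGroup_sInf fun σ hσ => hσ.1.add
  · exact continuousSMul_sInf fun σ hσ => hσ.1.smul
  · intro B hB
    apply le_antisymm
    · exact induced_mono (sInf_le hmem)
    · change _ ≤ TopologicalSpace.induced _ (sInf _)
      rw [sInf_eq_iInf', induced_iInf]
      exact le_iInf fun σ => (σ.2.2.1 B hB).ge
  · exact le_sInf fun σ hσ => hσ.2.2.1

/-- Every Cauchy sequence of the topological group `(X, σ)` converges. -/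
def SeqCompleteFor {X : Type*} [AddCommGroup X] (σ : ExtraTopology X) : Prop :=
  ∀ u : ℕ → X, (∀ V ∈ @nhds X σ.top 0, ∃ N : ℕ, ∀ m ≥ N, ∀ n ≥ N, u m - u n ∈ V) →
    ∃ x : X, Tendsto u atTop (@nhds X σ.top x)

/-- `s` is sequentially open: a sequence that converges to a point of `s` is eventually in `s`. -/
def SeqOpenFor {X : Type*} (σ : ExtraTopology X) (s : Set X) : Prop :=
  ∀ x ∈ s, ∀ u : ℕ → X, Tendsto u atTop (@nhds X σ.top x) → ∀ᶠ n in atTop, u n ∈ s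

/-- `(X, σ)` is C-sequential: every convex sequentially open set is open. -/
def CSequentialFor {X : Type*} [AddCommGroup X] [Module ℝ X] (σ : ExtraTopology X) : Prop :=
  ∀ s : Set X, Convex ℝ s → SeqOpenFor σ s → IsOpen[σ.top] s

/-- A one-parameter semigroup of bounded linear operators. -/
structure IsOperatorSemigroup (𝕜 E : Type*) [RCLike 𝕜] [NormedAddCommGroup E]
    [NormedSpace 𝕜 E] (S : ℝ≥0 → E →L[𝕜] E) : Prop where
  zero : S 0 = ContinuousLinearMap.id 𝕜 E
  add : ∀ s t : ℝ≥0, S (t + s) = (S t).comp (S s)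

/-- Exponential boundedness: `‖S t‖ ≤ M * exp (ω * t)` for all `t ≥ 0`. -/
def IsExpBounded (𝕜 E : Type*) [RCLike 𝕜] [NormedAddCommGroup E]
    [NormedSpace 𝕜 E] (S : ℝ≥0 → E →L[𝕜] E) : Prop :=
  ∃ M : ℝ, 1 ≤ M ∧ ∃ ω : ℝ, ∀ t : ℝ≥0, ‖S t‖ ≤ M * Real.exp (ω * t)

/-- Strong continuity on `[0, ∞)` with respect to the topology `σ`. -/
def IsStronglyContinuous (𝕜 E : Type*) [RCLike 𝕜] [NormedAddCommGroup E]
    [NormedSpace 𝕜 E] (σ : ExtraTopology E) (S : ℝ≥0 → E →L[𝕜] E) : Prop :=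
  ∀ x : E, Continuous[inferInstance, σ.top] fun t : ℝ≥0 => S t x

/-- Local bi-equicontinuity: if `(u n)` is norm-bounded and `τ`-converges to `x`, then
`S t (u n - x) → 0` in `τ`, uniformly for `t` in `[0, T]`, for every `T`. -/
def IsLocallyBiEquicontinuous (𝕜 X : Type*) [RCLike 𝕜] [NormedAddCommGroup X]
    [NormedSpace 𝕜 X]
    (τ : ExtraTopology X) (S : ℝ≥0 → X →L[𝕜] X) : Prop :=
  ∀ (u : ℕ → X) (x : X), IsBounded (Set.range u) → Tendsto u atTop (@nhds X τ.top x) →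
    ∀ T : ℝ≥0, ∀ V ∈ @nhds X τ.top 0, ∀ᶠ n in atTop, ∀ t ≤ T, S t (u n - x) ∈ V

/-- A locally `τ`-bi-continuous semigroup. -/
structure IsLocallyBiContinuousSemigroup (𝕜 X : Type*) [RCLike 𝕜] [NormedAddCommGroup X]
    [NormedSpace 𝕜 X] (τ : ExtraTopology X) (S : ℝ≥0 → X →L[𝕜] X) : Prop where
  semigroup : IsOperatorSemigroup 𝕜 X S
  expBounded : IsExpBounded 𝕜 X S
  stronglyContinuous : IsStronglyContinuous 𝕜 X τ S
  locallyBiEquicontinuous : IsLocallyBiEquicontinuous 𝕜 X τ S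

/-- The space `X°` of the functionals in the norm dual that are sequentially `τ`-continuous on
norm-bounded sets; it carries the norm of the dual space. -/
def circDual (𝕜 : Type*) [RCLike 𝕜] {X : Type*} [NormedAddCommGroup X] [NormedSpace 𝕜 X]
    (τ : ExtraTopology X) : Submodule 𝕜 (StrongDual 𝕜 X) where
  carrier := {f | ∀ B : Set X, IsBounded B → ∀ u : ℕ → X, (∀ n, u n ∈ B) → ∀ x ∈ B,
    Tendsto u atTop (@nhds X τ.top x) → Tendsto (fun n => f (u n)) atTop (𝓝 (f x))}
  zero_mem' := fun _ _ _ _ _ _ _ => by simp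
  add_mem' := fun hf hg B hB u hu x hx h => (hf B hB u hu x hx h).add (hg B hB u hu x hx h)
  smul_mem' := fun c _ hf B hB u hu x hx h => (hf B hB u hu x hx h).const_smul c

/-- The topology on `X°` of uniform convergence on the norm-compact subsets of `X`, induced from
the topology of compact convergence on the dual space. -/
def compactConvergenceTopology (𝕜 : Type*) [RCLike 𝕜] {X : Type*} [NormedAddCommGroup X]
    [NormedSpace 𝕜 X] (τ : ExtraTopology X) : ExtraTopology (circDual 𝕜 τ) :=
  ⟨TopologicalSpace.induced
    (fun f => (show CompactConvergenceCLM (RingHom.id 𝕜) X 𝕜 from (f : StrongDual 𝕜 X)))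
    inferInstance⟩

/-!
Only the behaviour of each `S t` along bounded `τ`-convergent sequences matters for the invariance
of `X°`: if `u n → x` is such a sequence then `S t (u n - x)` is a bounded `τ`-null sequence, so
`f (S t (u n - x)) → 0` for `f ∈ X°`. Algebra and norm estimates pass to the transposes.

For continuity, `t ↦ f (S t x)` is continuous, because along a convergent sequence of times the
points `S t x` form a bounded `τ`-convergent sequence. As the functionals `f ∘ S t` are locally
bounded in norm, they are locally uniformly Lipschitz, hence `(t, x) ↦ f (S t x)` is jointly
continuous. Currying then gives continuity in `t` for uniform convergence on compact sets.
-/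

section CompactConvergence

theorem continuous_uncurry_of_isBoundedUnder_norm {T 𝕜 E G : Type*} [TopologicalSpace T]
    [NontriviallyNormedField 𝕜] [SeminormedAddCommGroup E] [NormedSpace 𝕜 E]
    [SeminormedAddCommGroup G] [NormedSpace 𝕜 G] {F : T → E →L[𝕜] G}
    (hbound : ∀ t, IsBoundedUnder (· ≤ ·) (𝓝 t) fun s => ‖F s‖)
    (hF : ∀ x, Continuous fun t => F t x) : Continuous fun p : T × E => F p.1 p.2 := by
  refine continuous_iff_continuousAt.mpr fun ⟨t, x⟩ => ?_
  obtain ⟨C, hC⟩ := hbound t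
  rw [eventually_map] at hC
  have hlip : ∀ s ∈ {s | ‖F s‖ ≤ C}, LipschitzOnWith C.toNNReal (F s) Set.univ := fun s hs =>
    ((F s).lipschitz.weaken (NNReal.le_toNNReal_of_coe_le hs)).lipschitzOnWith
  have hcont : ContinuousOn (fun p : E × T => F p.2 p.1) (Set.univ ×ˢ {s | ‖F s‖ ≤ C}) :=
    continuousOn_prod_of_continuousOn_lipschitzOnWith _ C.toNNReal
      (fun y _ => (hF y).continuousOn) hlip
  exact (hcont.continuousAt (prod_mem_nhds univ_mem hC)).comp_of_eq
    continuous_swap.continuousAt rfl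

theorem continuous_compactConvergenceCLM_of_uncurry {T 𝕜 E G : Type*} [TopologicalSpace T]
    [NormedField 𝕜] [AddCommGroup E] [Module 𝕜 E] [TopologicalSpace E] [AddCommGroup G]
    [Module 𝕜 G] [UniformSpace G] [IsUniformAddGroup G]
    {F : T → CompactConvergenceCLM (RingHom.id 𝕜) E G}
    (hF : Continuous fun p : T × E => F p.1 p.2) : Continuous F :=
  (UniformConvergenceCLM.isEmbedding_coeFn _ _ _).continuous_iff.mpr
    ((ContinuousMap.continuous_iff_continuous_uniformOnFun _).mp
      (ContinuousMap.curry ⟨_, hF⟩).continuous)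

end CompactConvergence

section CircDual

variable {𝕜 X Y : Type*} [RCLike 𝕜] [NormedAddCommGroup X] [NormedSpace 𝕜 X]
  [NormedAddCommGroup Y] [NormedSpace 𝕜 Y] {σ : ExtraTopology X} {τ : ExtraTopology Y}

theorem mem_circDual_iff {f : StrongDual 𝕜 X} :
    f ∈ circDual 𝕜 σ ↔ ∀ (u : ℕ → X) (x : X), IsBounded (Set.range u) →
      Tendsto u atTop (@nhds X σ.top x) → Tendsto (fun n => f (u n)) atTop (𝓝 (f x)) := by
  refine ⟨fun hf u x hu hx => ?_, fun hf B hB u hu x _ hx => ?_⟩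
  · exact hf (insert x (Set.range u)) (isBounded_insert.mpr hu) u
      (fun n => Set.mem_insert_of_mem _ (Set.mem_range_self n)) x (Set.mem_insert _ _) hx
  · exact hf u x (hB.subset (Set.range_subset_iff.mpr hu)) hx

theorem comp_mem_circDual {A : X →L[𝕜] Y}
    (hA : ∀ (u : ℕ → X) (x : X), IsBounded (Set.range u) → Tendsto u atTop (@nhds X σ.top x) →
      Tendsto (fun n => A (u n - x)) atTop (@nhds Y τ.top 0))
    {f : StrongDual 𝕜 Y} (hf : f ∈ circDual 𝕜 τ) : f.comp A ∈ circDual 𝕜 σ := by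
  refine mem_circDual_iff.mpr fun u x hu hx => ?_
  have hbounded : IsBounded (Set.range fun n => A (u n - x)) := by
    obtain ⟨C, hC⟩ := hu.exists_norm_le
    refine isBounded_iff_forall_norm_le.mpr ⟨‖A‖ * (C + ‖x‖), ?_⟩
    rintro _ ⟨n, rfl⟩
    have hn : ‖u n - x‖ ≤ C + ‖x‖ := norm_sub_le_of_le (hC _ ⟨n, rfl⟩) le_rfl
    exact A.le_opNorm_of_le hn
  have hnull : Tendsto (fun n => f (A (u n - x))) atTop (𝓝 0) := by
    simpa only [map_zero] using mem_circDual_iff.mp hf _ 0 hbounded (hA u x hu hx)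
  refine tendsto_sub_nhds_zero_iff.mp ?_
  simpa only [map_sub, ContinuousLinearMap.comp_apply] using hnull

/-- The transpose `f ↦ f ∘ A` of a bounded operator `A : X → Y`, as an operator `Y° → X°`. That it
maps `Y°` into `X°` is a hypothesis; `comp_mem_circDual` provides it. -/
noncomputable def circDualMap (A : X →L[𝕜] Y)
    (hA : ∀ f ∈ circDual 𝕜 τ, f.comp A ∈ circDual 𝕜 σ) : circDual 𝕜 τ →L[𝕜] circDual 𝕜 σ :=
  (ContinuousLinearMap.precomp 𝕜 A).restrict hA

theorem coe_circDualMap_apply (A : X →L[𝕜] Y)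
    (hA : ∀ f ∈ circDual 𝕜 τ, f.comp A ∈ circDual 𝕜 σ) (f : circDual 𝕜 τ) :
    (circDualMap A hA f : StrongDual 𝕜 X) = (f : StrongDual 𝕜 Y).comp A :=
  rfl

theorem norm_circDualMap_apply_le (A : X →L[𝕜] Y)
    (hA : ∀ f ∈ circDual 𝕜 τ, f.comp A ∈ circDual 𝕜 σ) (f : circDual 𝕜 τ) :
    ‖circDualMap A hA f‖ ≤ ‖A‖ * ‖f‖ :=
  (ContinuousLinearMap.opNorm_comp_le (f : StrongDual 𝕜 Y) A).trans_eq (mul_comm _ _)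

end CircDual

section Semigroup

variable {𝕜 X : Type*} [RCLike 𝕜] [NormedAddCommGroup X] [NormedSpace 𝕜 X]
  {τ : ExtraTopology X} {S : ℝ≥0 → X →L[𝕜] X}

theorem IsLocallyBiEquicontinuous.tendsto_apply_sub (hS : IsLocallyBiEquicontinuous 𝕜 X τ S)
    (t : ℝ≥0) (u : ℕ → X) (x : X) (hu : IsBounded (Set.range u))
    (hx : Tendsto u atTop (@nhds X τ.top x)) :
    Tendsto (fun n => S t (u n - x)) atTop (@nhds X τ.top 0) := fun V hV =>
  (hS u x hu hx t V hV).mono fun _ hn => hn t le_rfl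

theorem IsExpBounded.isBoundedUnder_norm (hS : IsExpBounded 𝕜 X S) (t : ℝ≥0) :
    IsBoundedUnder (· ≤ ·) (𝓝 t) fun s => ‖S s‖ := by
  obtain ⟨M, -, ω, hM⟩ := hS
  have hcont : Continuous fun s : ℝ≥0 => M * Real.exp (ω * s) := by fun_prop
  exact (hcont.tendsto t).isBoundedUnder_le.mono_le (.of_forall hM)

theorem IsStronglyContinuous.continuous_apply_of_mem_circDual
    (hS : IsStronglyContinuous 𝕜 X τ S) (hbound : IsExpBounded 𝕜 X S) {f : StrongDual 𝕜 X}
    (hf : f ∈ circDual 𝕜 τ) (x : X) : Continuous fun t => f (S t x) := by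
  rw [continuous_iff_seqContinuous]
  intro s t hs
  have horbit : Tendsto (fun n => S (s n) x) atTop (@nhds X τ.top (S t x)) :=
    (@Continuous.tendsto _ _ _ τ.top _ (hS x) t).comp hs
  have hbounded : IsBounded (Set.range fun n => S (s n) x) := by
    obtain ⟨C, hC⟩ := (hs.isBoundedUnder_comp (hbound.isBoundedUnder_norm t)).bddAbove_range
    refine isBounded_iff_forall_norm_le.mpr ⟨C * ‖x‖, ?_⟩
    rintro _ ⟨n, rfl⟩
    exact (S (s n)).le_of_opNorm_le (hC ⟨n, rfl⟩) x
  exact mem_circDual_iff.mp hf _ _ hbounded horbit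

theorem isOperatorSemigroup_circDualMap (hS : IsOperatorSemigroup 𝕜 X S)
    (hinv : ∀ t, ∀ f ∈ circDual 𝕜 τ, f.comp (S t) ∈ circDual 𝕜 τ) :
    IsOperatorSemigroup 𝕜 (circDual 𝕜 τ) fun t => circDualMap (S t) (hinv t) where
  zero := by
    ext f x
    simp only [coe_circDualMap_apply, hS.zero, ContinuousLinearMap.comp_id,
      ContinuousLinearMap.id_apply]
  add s t := by
    ext f x
    simp only [coe_circDualMap_apply, add_comm t s, hS.add t s, ContinuousLinearMap.comp_apply]

theorem isExpBounded_circDualMap (hS : IsExpBounded 𝕜 X S)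
    (hinv : ∀ t, ∀ f ∈ circDual 𝕜 τ, f.comp (S t) ∈ circDual 𝕜 τ) :
    IsExpBounded 𝕜 (circDual 𝕜 τ) fun t => circDualMap (S t) (hinv t) := by
  obtain ⟨M, hM, ω, hle⟩ := hS
  exact ⟨M, hM, ω, fun t => (ContinuousLinearMap.opNorm_le_bound _ (norm_nonneg (S t))
    (norm_circDualMap_apply_le (S t) (hinv t))).trans (hle t)⟩

theorem isStronglyContinuous_circDualMap (hS : IsStronglyContinuous 𝕜 X τ S)
    (hbound : IsExpBounded 𝕜 X S)
    (hinv : ∀ t, ∀ f ∈ circDual 𝕜 τ, f.comp (S t) ∈ circDual 𝕜 τ) :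
    IsStronglyContinuous 𝕜 (circDual 𝕜 τ) (compactConvergenceTopology 𝕜 τ)
      fun t => circDualMap (S t) (hinv t) := by
  intro f
  have hnorm (t : ℝ≥0) :
      IsBoundedUnder (· ≤ ·) (𝓝 t) fun s => ‖(f : StrongDual 𝕜 X).comp (S s)‖ := by
    obtain ⟨C, hC⟩ := hbound.isBoundedUnder_norm t
    refine ⟨‖(f : StrongDual 𝕜 X)‖ * C, eventually_map.mpr ?_⟩
    filter_upwards [eventually_map.mp hC] with s hs
    exact (ContinuousLinearMap.opNorm_comp_le _ _).trans (by gcongr)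
  exact continuous_induced_rng.mpr <| continuous_compactConvergenceCLM_of_uncurry <|
    continuous_uncurry_of_isBoundedUnder_norm hnorm
      fun x => hS.continuous_apply_of_mem_circDual hbound f.2 x

end Semigroup

theorem mainTheorem8_general {𝕜 : Type*} [RCLike 𝕜] {X : Type*} [NormedAddCommGroup X]
    [NormedSpace 𝕜 X] (τ : ExtraTopology X) (S : ℝ≥0 → X →L[𝕜] X)
    (hsemigroup : IsOperatorSemigroup 𝕜 X S) (hbound : IsExpBounded 𝕜 X S)
    (hcont : IsStronglyContinuous 𝕜 X τ S)
    (hseq : ∀ (t : ℝ≥0) (u : ℕ → X) (x : X), IsBounded (Set.range u) →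
      Tendsto u atTop (@nhds X τ.top x) →
      Tendsto (fun n => S t (u n - x)) atTop (@nhds X τ.top 0)) :
    ∃ Scirc : ℝ≥0 → circDual 𝕜 τ →L[𝕜] circDual 𝕜 τ,
      (∀ (t : ℝ≥0) (f : circDual 𝕜 τ),
        (Scirc t f : StrongDual 𝕜 X) = (f : StrongDual 𝕜 X).comp (S t)) ∧
      IsOperatorSemigroup 𝕜 (circDual 𝕜 τ) Scirc ∧
      IsExpBounded 𝕜 (circDual 𝕜 τ) Scirc ∧
      IsStronglyContinuous 𝕜 (circDual 𝕜 τ) (compactConvergenceTopology 𝕜 τ) Scirc :=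
  have hinv (t : ℝ≥0) (f : StrongDual 𝕜 X) (hf : f ∈ circDual 𝕜 τ) :
      f.comp (S t) ∈ circDual 𝕜 τ :=
    comp_mem_circDual (hseq t) hf
  ⟨fun t => circDualMap (S t) (hinv t), fun t => coe_circDualMap_apply (S t) (hinv t),
    isOperatorSemigroup_circDualMap hsemigroup hinv, isExpBounded_circDualMap hbound hinv,
    isStronglyContinuous_circDualMap hcont hbound hinv⟩

theorem mainTheorem8 {𝕜 : Type*} [RCLike 𝕜] {X : Type*} [NormedAddCommGroup X] [NormedSpace 𝕜 X]
    [Module ℝ X] [IsScalarTower ℝ 𝕜 X] (τ : ExtraTopology X)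
    (hSaks : IsSaksSpace 𝕜 X τ)
    (hComplete : SeqCompleteFor (mixedTopology 𝕜 τ))
    (hCseq : CSequentialFor (mixedTopology 𝕜 τ))
    (S : ℝ≥0 → X →L[𝕜] X) (hS : IsLocallyBiContinuousSemigroup 𝕜 X τ S) :
    ∃ Scirc : ℝ≥0 → circDual 𝕜 τ →L[𝕜] circDual 𝕜 τ,
      (∀ (t : ℝ≥0) (f : circDual 𝕜 τ),
        (Scirc t f : StrongDual 𝕜 X) = (f : StrongDual 𝕜 X).comp (S t)) ∧
      IsOperatorSemigroup 𝕜 (circDual 𝕜 τ) Scirc ∧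
      IsExpBounded 𝕜 (circDual 𝕜 τ) Scirc ∧
      IsStronglyContinuous 𝕜 (circDual 𝕜 τ) (compactConvergenceTopology 𝕜 τ) Scirc :=
  mainTheorem8_general τ S hS.semigroup hS.expBounded hS.stronglyContinuous
    hS.locallyBiEquicontinuous.tendsto_apply_sub
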